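/- Let $X$ be a Banach space over $\mathbb{K}\in\{\mathbb{R},\mathbb{C}\}$ and let $\mathcal{T}=(T_t)_{t\ge 0}$ be a $C_0$-semigroup of bounded linear operators on $X$, i.e. $T_0=I$, $T_tT_s=T_{t+s}$ for $t,s\ge 0$, and $\lim_{t\to s}T_tx=T_sx$ for all $x\in X$, $s\ge 0$. Call $x\in X$ *absolutely mean irregular* for $\mathcal{T}$ if $$\liminf_{b\to\infty}\frac1b\int_0^b\|T_tx\|\,dt=0\quad\text{and}\quad\limsup_{b\to\infty}\frac1b\int_0^b\|T_tx\|\,dt=\infty,$$ and call a vector subspace $Y$ of $X$ an *absolutely mean irregular manifold* for $\mathcal{T}$ if every nonzero vector of $Y$ is absolutely mean irregular for $\mathcal{T}$. Suppose that the set $$\Big\{x\in X:\ \lim_{b\to\infty}\frac1b\int_0^b\|T_tx\|\,dt=0\Big\}$$ is dense in $X$ and that at least one of the following conditions holds: (a) $\displaystyle\limsup_{b\to\infty}\frac1b\int_0^b\|T_ty_0\|\,dt>0$ for some $y_0\in X$; (b) $\displaystyle\limsup_{t\to\infty}\frac{\|T_t\|}{t}>0$; (c) $X$ is a Hilbert space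 and $\displaystyle\limsup_{t\to\infty}\frac{\|T_t\|}{t^{1/2}}>0$; (d) there is an eigenvalue $\lambda\in\sigma_p(A)$ with $\operatorname{Re}\lambda\ge 0$, where $A$ is the infinitesimal generator of $\mathcal{T}$, defined by $Ax=\lim_{h\to0^+}(T_hx-x)/h$ on the set of all $x\in X$ for which this limit exists. (The upper limits are taken in $[0,\infty]$.) Then the set of absolutely mean irregular vectors for $\mathcal{T}$ is residual in $X$. If, in addition, $X$ is separable, then $\mathcal{T}$ admits a dense absolutely mean irregular manifold. -/

import Mathlib

open Filter Topology
open scoped NNReal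

/-- A `C₀`-semigroup `(T_t)_{t ≥ 0}` of bounded linear operators on the normed space `X`. -/
structure C0Semigroup (𝕜 : Type*) [RCLike 𝕜] (X : Type*) [NormedAddCommGroup X]
    [NormedSpace 𝕜 X] where
  /-- The operator `T_t`. -/
  op : ℝ≥0 → X →L[𝕜] X
  op_zero : op 0 = ContinuousLinearMap.id 𝕜 X
  op_comp : ∀ t s : ℝ≥0, (op t).comp (op s) = op (t + s)
  tendsto_op : ∀ (x : X) (s : ℝ≥0), Tendsto (fun t => op t x) (𝓝 s) (𝓝 (op s x))

namespace C0Semigroup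

variable {𝕜 : Type*} [RCLike 𝕜] {X : Type*} [NormedAddCommGroup X] [NormedSpace 𝕜 X]

/-- The integral Cesàro mean `(1/b) ∫_0^b ‖T_t x‖ dt`. -/
noncomputable def mean (T : C0Semigroup 𝕜 X) (x : X) (b : ℝ) : ℝ :=
  (1 / b) * ∫ t in (0 : ℝ)..b, ‖T.op t.toNNReal x‖

/-- `x` is an absolutely mean irregular vector: the Cesàro means have lower limit `0` and
upper limit `∞` (both taken in the extended reals). -/
def IsAbsMeanIrregular (T : C0Semigroup 𝕜 X) (x : X) : Prop :=
  liminf (fun b : ℝ => (T.mean x b : EReal)) atTop = 0 ∧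
    limsup (fun b : ℝ => (T.mean x b : EReal)) atTop = ⊤

/-- A vector subspace all of whose nonzero vectors are absolutely mean irregular. -/
def IsAbsMeanIrregularManifold (T : C0Semigroup 𝕜 X) (Y : Submodule 𝕜 X) : Prop :=
  ∀ y ∈ Y, y ≠ 0 → T.IsAbsMeanIrregular y

/-- `y` is the limit of `(T_h x - x) / h` as `h → 0⁺`. -/
def HasGeneratorValue (T : C0Semigroup 𝕜 X) (x y : X) : Prop :=
  Tendsto (fun h : ℝ≥0 => (((h : ℝ) : 𝕜))⁻¹ • (T.op h x - x)) (𝓝[>] 0) (𝓝 y)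

theorem HasGeneratorValue.unique {T : C0Semigroup 𝕜 X} {x y z : X}
    (hy : T.HasGeneratorValue x y) (hz : T.HasGeneratorValue x z) : y = z :=
  tendsto_nhds_unique hy hz

theorem HasGeneratorValue.zero (T : C0Semigroup 𝕜 X) : T.HasGeneratorValue 0 0 := by
  simp [HasGeneratorValue]

theorem HasGeneratorValue.add {T : C0Semigroup 𝕜 X} {x₁ x₂ y₁ y₂ : X}
    (h₁ : T.HasGeneratorValue x₁ y₁) (h₂ : T.HasGeneratorValue x₂ y₂) :
    T.HasGeneratorValue (x₁ + x₂) (y₁ + y₂) := by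
  refine (Tendsto.add h₁ h₂).congr fun h => ?_
  rw [← smul_add, map_add]
  congr 1
  abel

theorem HasGeneratorValue.smul {T : C0Semigroup 𝕜 X} {x y : X} (c : 𝕜)
    (hx : T.HasGeneratorValue x y) : T.HasGeneratorValue (c • x) (c • y) := by
  refine (Tendsto.const_smul hx c).congr fun h => ?_
  rw [smul_comm, smul_sub, map_smul]

/-- The infinitesimal generator `A x = lim_{h → 0⁺} (T_h x - x) / h`, an unbounded operator whose
domain consists of the `x` for which the limit exists. -/
noncomputable def generator (T : C0Semigroup 𝕜 X) : X →ₗ.[𝕜] X where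
  domain :=
    { carrier := {x | ∃ y, T.HasGeneratorValue x y}
      zero_mem' := ⟨0, HasGeneratorValue.zero T⟩
      add_mem' := fun ⟨y, hy⟩ ⟨z, hz⟩ => ⟨y + z, hy.add hz⟩
      smul_mem' := fun c _ ⟨y, hy⟩ => ⟨c • y, hy.smul c⟩ }
  toFun :=
    { toFun := fun x => x.2.choose
      map_add' := fun x y =>
        (x + y).2.choose_spec.unique (x.2.choose_spec.add y.2.choose_spec)
      map_smul' := fun c x => (c • x).2.choose_spec.unique (x.2.choose_spec.smul c) }

end C0Semigroup

/-- The point spectrum (set of eigenvalues) of an unbounded operator. -/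
def LinearPMap.pointSpectrum {𝕜 : Type*} [RCLike 𝕜] {X : Type*} [NormedAddCommGroup X]
    [NormedSpace 𝕜 X] (A : X →ₗ.[𝕜] X) : Set 𝕜 :=
  {μ | ∃ x : A.domain, (x : X) ≠ 0 ∧ A x = μ • (x : X)}

/-- The norm of the normed space `X` comes from an inner product. (For complete `X`, this says
that `X` is a Hilbert space.) -/
def NormFromInner (𝕜 : Type*) [RCLike 𝕜] (X : Type*) [NormedAddCommGroup X]
    [inst : NormedSpace 𝕜 X] : Prop :=
  ∃ I : InnerProductSpace 𝕜 X, I.toNormedSpace = inst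

/-!
For `b > 0` the Cesàro mean `x ↦ T.mean x b` is a continuous seminorm, and the vectors whose means
tend to `0` form a subspace `T.meanNull`, dense by hypothesis. Everything rests on one fact: these
seminorms are not equicontinuous for `b ≥ 1`, that is, `¬ T.IsMeanBounded`.

*Why each condition gives this.* If the seminorms were equicontinuous, density of `T.meanNull` would
make all means tend to `0`, which excludes a vector whose means have positive upper limit. An
eigenvector whose eigenvalue has nonnegative real part is such a vector, because `‖T_t x‖ ≥ ‖x‖`.
For the two growth conditions, equicontinuity makes `S = T_1`
absolutely Cesàro bounded, `∑ n < N, ‖S ^ n x‖ ≤ C N ‖x‖`. Then `‖S ^ n‖ = O(n)`, and inserting this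
into `‖S ^ j x‖ ≥ ‖S ^ n x‖ / ‖S ^ (n - j)‖` produces a harmonic sum, so that in fact
`‖S ^ n‖ = O(n / log n)` (`AbsCesaroBoundedWith.norm_pow_mul_harmonic_le`). On a Hilbert space, the
same hypothesis applied to Rademacher sums, with Khintchine's inequality, gives the square function
bound `∑ t < N, (∑ k < n, ‖S ^ t (u k)‖ ^ 2) ^ (1 / 2) ≤ 2 C N √n` for `‖u k‖ ≤ 1`
(`AbsCesaroBoundedWith.sum_sqrt_le`). For almost norming `u k` it yields `‖S ^ n‖ = O(√n)`, and
again the harmonic sum that this bound produces improves it to `o(√n)`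
(`AbsCesaroBoundedWith.sum_norm_pow_le_of_harmonic`). Both conclusions pass from `S` to `T_t`.

*Why it suffices.* Failure of equicontinuity gives arbitrarily small vectors in `T.meanNull` with
arbitrarily large means at arbitrarily late times (`C0Semigroup.exists_small_mem_meanNull`). Hence
both defining conditions of absolute mean irregularity hold on countable intersections of dense open
sets. For the manifold, the same vectors form a gliding hump `u n`
(`C0Semigroup.exists_gliding_hump`). Sums of the `u n` over disjoint infinite index sets, added to a
dense sequence in `T.meanNull`, span the required subspace: in a nonzero combination the humps of
at least one index set survive.
-/

/-! ### Powers of absolutely Cesàro bounded operators -/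

section PowerGrowth

variable {𝕜 : Type*} [RCLike 𝕜] {X : Type*} [NormedAddCommGroup X] [NormedSpace 𝕜 X]

/-- `S` is absolutely Cesàro bounded with constant `C`: the arithmetic means of
`‖x‖, ‖S x‖, …, ‖S ^ (N - 1) x‖` are at most `C * ‖x‖`. -/
def AbsCesaroBoundedWith (S : X →L[𝕜] X) (C : ℝ) : Prop :=
  ∀ (N : ℕ) (x : X), ∑ n ∈ Finset.range N, ‖(S ^ n) x‖ ≤ C * N * ‖x‖

theorem norm_pow_add_apply_le (S : X →L[𝕜] X) (m n : ℕ) (x : X) :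
    ‖(S ^ (m + n)) x‖ ≤ ‖S ^ m‖ * ‖(S ^ n) x‖ := by
  rw [pow_add]
  exact (S ^ m).le_opNorm _

theorem AbsCesaroBoundedWith.norm_pow_le {S : X →L[𝕜] X} {C : ℝ} (hC : 0 < C)
    (hS : AbsCesaroBoundedWith S C) (n : ℕ) : ‖S ^ n‖ ≤ C * (n + 1) := by
  refine ContinuousLinearMap.opNorm_le_bound _ (by positivity) fun x => ?_
  have h := hS (n + 1) x
  simp only [Nat.cast_add, Nat.cast_one] at h
  exact (Finset.single_le_sum (f := fun k => ‖(S ^ k) x‖) (fun _ _ => norm_nonneg _)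
    (Finset.self_mem_range_succ n)).trans h

/-- If `‖S ^ n x‖` is large, then `‖S ^ j x‖ ≥ ‖S ^ n x‖ / ‖S ^ (n - j)‖`, and the linear bound on
`‖S ^ (n - j)‖` makes the sum over `j` pick up a harmonic sum. -/
theorem AbsCesaroBoundedWith.norm_pow_mul_harmonic_le {S : X →L[𝕜] X} {C : ℝ} (hC : 0 < C)
    (hS : AbsCesaroBoundedWith S C) (n : ℕ) :
    ‖S ^ n‖ * ∑ j ∈ Finset.range (n + 1), 1 / ((j : ℝ) + 1) ≤ C * C * (n + 1) := by
  have hpos : 0 < ∑ j ∈ Finset.range (n + 1), 1 / ((j : ℝ) + 1) :=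
    Finset.sum_pos (fun _ _ => by positivity) ⟨0, by simp⟩
  rw [← le_div_iff₀ hpos]
  refine ContinuousLinearMap.opNorm_le_bound _ (by positivity) fun x => ?_
  rw [div_mul_eq_mul_div, le_div_iff₀ hpos, Finset.mul_sum, ← Finset.sum_range_reflect]
  calc ∑ j ∈ Finset.range (n + 1), ‖(S ^ n) x‖ * (1 / (((n + 1 - 1 - j : ℕ) : ℝ) + 1))
      ≤ ∑ j ∈ Finset.range (n + 1), C * ‖(S ^ j) x‖ := by
        refine Finset.sum_le_sum fun j hj => ?_
        obtain ⟨k, rfl⟩ := Nat.exists_eq_add_of_le' (Nat.lt_succ_iff.1 (Finset.mem_range.1 hj))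
        rw [show k + j + 1 - 1 - j = k by omega, mul_one_div, div_le_iff₀ (by positivity)]
        calc ‖(S ^ (k + j)) x‖ ≤ ‖S ^ k‖ * ‖(S ^ j) x‖ := norm_pow_add_apply_le S k j x
          _ ≤ C * (k + 1) * ‖(S ^ j) x‖ := by
            gcongr
            exact hS.norm_pow_le hC k
          _ = C * ‖(S ^ j) x‖ * (k + 1) := by ring
    _ ≤ C * (C * (n + 1) * ‖x‖) := by
        rw [← Finset.mul_sum]
        have h := hS (n + 1) x
        simp only [Nat.cast_add, Nat.cast_one] at h
        gcongr
    _ = C * C * (n + 1) * ‖x‖ := by ring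

/-- An absolutely Cesàro bounded operator has powers of norm `o(n)`. -/
theorem AbsCesaroBoundedWith.tendsto_norm_pow_div {S : X →L[𝕜] X} {C : ℝ} (hC : 0 < C)
    (hS : AbsCesaroBoundedWith S C) :
    Tendsto (fun n : ℕ => ‖S ^ n‖ / (n : ℝ)) atTop (𝓝 0) := by
  have hh := (tendsto_add_atTop_iff_nat 1).2 Real.tendsto_sum_range_one_div_nat_succ_atTop
  have hlim := Tendsto.const_div_atTop hh (2 * (C * C))
  refine squeeze_zero' (Eventually.of_forall fun n => by positivity) ?_ hlim
  filter_upwards [eventually_ge_atTop 1] with n hn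
  have hn' : (1 : ℝ) ≤ n := by exact_mod_cast hn
  have hpos : 0 < ∑ j ∈ Finset.range (n + 1), 1 / ((j : ℝ) + 1) :=
    Finset.sum_pos (fun _ _ => by positivity) ⟨0, by simp⟩
  rw [div_le_div_iff₀ (by positivity) hpos]
  nlinarith [hS.norm_pow_mul_harmonic_le hC n, mul_pos hC hC]

/-- By the Cauchy–Schwarz inequality applied to `‖S ^ n x‖ ≤ ‖S ^ (n - j)‖ * ‖S ^ j x‖`, the
norm of a power is controlled by the mean of the norms of the lower powers. -/
theorem AbsCesaroBoundedWith.mul_norm_pow_le_sum {S : X →L[𝕜] X} {C : ℝ} (hC : 0 < C)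
    (hS : AbsCesaroBoundedWith S C) (n : ℕ) :
    ((n : ℝ) + 1) * ‖S ^ n‖ ≤ C * ∑ k ∈ Finset.range (n + 1), ‖S ^ k‖ := by
  set A := ∑ k ∈ Finset.range (n + 1), ‖S ^ k‖ with hA
  have hA0 : 0 ≤ A := Finset.sum_nonneg fun _ _ => norm_nonneg _
  have hn : (0 : ℝ) < (n : ℝ) + 1 := by positivity
  rw [← le_div_iff₀' hn]
  refine ContinuousLinearMap.opNorm_le_bound _ (by positivity) fun x => ?_
  have h1 : ((n : ℝ) + 1) * √‖(S ^ n) x‖ ≤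
      √(∑ j ∈ Finset.range (n + 1), ‖S ^ (n - j)‖) *
        √(∑ j ∈ Finset.range (n + 1), ‖(S ^ j) x‖) := by
    calc ((n : ℝ) + 1) * √‖(S ^ n) x‖ = ∑ j ∈ Finset.range (n + 1), √‖(S ^ n) x‖ := by simp
      _ ≤ ∑ j ∈ Finset.range (n + 1), √‖S ^ (n - j)‖ * √‖(S ^ j) x‖ := by
        refine Finset.sum_le_sum fun j hj => ?_
        obtain ⟨k, rfl⟩ := Nat.exists_eq_add_of_le' (Nat.lt_succ_iff.1 (Finset.mem_range.1 hj))
        rw [Nat.add_sub_cancel, ← Real.sqrt_mul (norm_nonneg _)]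
        exact Real.sqrt_le_sqrt (norm_pow_add_apply_le S k j x)
      _ ≤ _ := Real.sum_sqrt_mul_sqrt_le _ (fun _ => norm_nonneg _) fun _ => norm_nonneg _
  have h2 : ∑ j ∈ Finset.range (n + 1), ‖S ^ (n - j)‖ = A :=
    Finset.sum_range_reflect (fun k => ‖S ^ k‖) (n + 1)
  rw [h2, ← Real.sqrt_mul hA0] at h1
  have h3 := pow_le_pow_left₀ (by positivity) h1 2
  rw [mul_pow, Real.sq_sqrt (norm_nonneg _), Real.sq_sqrt
    (mul_nonneg hA0 (Finset.sum_nonneg fun _ _ => norm_nonneg _))] at h3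
  have h4 := hS (n + 1) x
  simp only [Nat.cast_add, Nat.cast_one] at h4
  have h5 := h3.trans (mul_le_mul_of_nonneg_left h4 hA0)
  rw [div_mul_eq_mul_div, le_div_iff₀ hn]
  refine le_of_mul_le_mul_left ?_ hn
  linarith

end PowerGrowth

/-! ### Rademacher averages -/

section SignAverage

variable {E : Type*} [NormedAddCommGroup E]

/-- The Rademacher average: the mean value of `f (± u 0 ± u 1 ± ⋯ ± u (n - 1))` over all `2 ^ n`
choices of signs, computed one sign at a time. -/
noncomputable def signAverage (u : ℕ → E) : ℕ → (E → ℝ) → ℝ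
  | 0, f => f 0
  | n + 1, f => signAverage u n fun x => (f (x + u n) + f (x - u n)) / 2

theorem signAverage_mono (u : ℕ → E) (n : ℕ) {f g : E → ℝ} (h : ∀ x, f x ≤ g x) :
    signAverage u n f ≤ signAverage u n g := by
  induction n generalizing f g with
  | zero => exact h 0
  | succ n ih => exact ih fun x => by linarith [h (x + u n), h (x - u n)]

theorem signAverage_add (u : ℕ → E) (n : ℕ) (f g : E → ℝ) :
    signAverage u n (fun x => f x + g x) = signAverage u n f + signAverage u n g := by
  induction n generalizing f g with
  | zero => rfl
  | succ n ih =>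
    simp only [signAverage]
    rw [← ih]
    congr 1
    ext x
    ring

theorem signAverage_const_mul (u : ℕ → E) (n : ℕ) (c : ℝ) (f : E → ℝ) :
    signAverage u n (fun x => c * f x) = c * signAverage u n f := by
  induction n generalizing f with
  | zero => rfl
  | succ n ih =>
    simp only [signAverage]
    rw [← ih]
    congr 1
    ext x
    ring

theorem signAverage_const (u : ℕ → E) (n : ℕ) (c : ℝ) : signAverage u n (fun _ => c) = c := by
  induction n with
  | zero => rfl
  | succ n ih =>
    simp only [signAverage]
    convert ih using 2
    ext
    ring

theorem signAverage_sum {ι : Type*} (u : ℕ → E) (n : ℕ) (s : Finset ι) (f : ι → E → ℝ) :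
    signAverage u n (fun x => ∑ i ∈ s, f i x) = ∑ i ∈ s, signAverage u n (f i) := by
  classical
  induction s using Finset.induction_on with
  | empty => simpa using signAverage_const u n 0
  | insert i s hi ih =>
    simp only [Finset.sum_insert hi]
    rw [signAverage_add, ih]

theorem signAverage_comp {F : Type*} [NormedAddCommGroup F] (L : E →+ F) (u : ℕ → E) (n : ℕ)
    (f : F → ℝ) :
    signAverage u n (fun x => f (L x)) = signAverage (fun k => L (u k)) n f := by
  induction n generalizing f with
  | zero => simp [signAverage]
  | succ n ih =>
    simp only [signAverage, map_add, map_sub]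
    exact ih fun y => (f (y + L (u n)) + f (y - L (u n))) / 2

theorem signAverage_norm_sq (𝕜 : Type*) [RCLike 𝕜] [InnerProductSpace 𝕜 E] (u : ℕ → E) (n : ℕ) :
    signAverage u n (fun x => ‖x‖ ^ 2) = ∑ k ∈ Finset.range n, ‖u k‖ ^ 2 := by
  induction n with
  | zero => simp [signAverage]
  | succ n ih =>
    rw [Finset.sum_range_succ, ← ih, ← signAverage_const u n (‖u n‖ ^ 2), ← signAverage_add,
      signAverage]
    congr 1
    ext x
    have := parallelogram_law_with_norm 𝕜 x (u n)
    linarith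

theorem signAverage_norm_pow_four_le (𝕜 : Type*) [RCLike 𝕜] [InnerProductSpace 𝕜 E] (u : ℕ → E)
    (n : ℕ) :
    signAverage u n (fun x => ‖x‖ ^ 4) ≤ 3 * (∑ k ∈ Finset.range n, ‖u k‖ ^ 2) ^ 2 := by
  induction n with
  | zero => simp [signAverage]
  | succ n ih =>
    have hpt : ∀ x : E, (‖x + u n‖ ^ 4 + ‖x - u n‖ ^ 4) / 2 ≤
        ‖x‖ ^ 4 + 6 * ‖u n‖ ^ 2 * ‖x‖ ^ 2 + ‖u n‖ ^ 4 := fun x => by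
      have h1 := norm_add_sq (𝕜 := 𝕜) x (u n)
      have h2 := norm_sub_sq (𝕜 := 𝕜) x (u n)
      have h3 : (RCLike.re (inner 𝕜 x (u n))) ^ 2 ≤ (‖x‖ * ‖u n‖) ^ 2 :=
        sq_le_sq.2 <| ((RCLike.abs_re_le_norm _).trans (norm_inner_le_norm x (u n))).trans
          (le_abs_self _)
      have h4 : ‖x + u n‖ ^ 4 = (‖x + u n‖ ^ 2) ^ 2 := by ring
      have h5 : ‖x - u n‖ ^ 4 = (‖x - u n‖ ^ 2) ^ 2 := by ring
      rw [h4, h5, h1, h2]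
      nlinarith [h3]
    rw [signAverage]
    refine (signAverage_mono u n hpt).trans ?_
    rw [signAverage_add, signAverage_add, signAverage_const_mul, signAverage_const,
      signAverage_norm_sq 𝕜, Finset.sum_range_succ]
    nlinarith [sq_nonneg (‖u n‖ ^ 2)]

/-- Khintchine's inequality `L² ≤ 2 L¹` for Rademacher sums in an inner product space. It follows
from the fourth moment bound through a pointwise lower bound of `‖x‖` by a combination of `‖x‖ ^ 2`
and `‖x‖ ^ 4`. -/
theorem sqrt_sum_norm_sq_le_signAverage (𝕜 : Type*) [RCLike 𝕜] [InnerProductSpace 𝕜 E] (u : ℕ → E)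
    (n : ℕ) :
    √(∑ k ∈ Finset.range n, ‖u k‖ ^ 2) ≤ 2 * signAverage u n (fun x => ‖x‖) := by
  set σ := √(∑ k ∈ Finset.range n, ‖u k‖ ^ 2) with hσ
  have hσ2 : σ ^ 2 = ∑ k ∈ Finset.range n, ‖u k‖ ^ 2 :=
    Real.sq_sqrt (Finset.sum_nonneg fun _ _ => by positivity)
  have hσ0 : 0 ≤ σ := Real.sqrt_nonneg _
  rcases hσ0.eq_or_lt with h0 | hpos
  · rw [← h0, ← signAverage_const u n 0]
    have := signAverage_mono u n (f := fun _ => 0) (g := fun x : E => ‖x‖) fun x => norm_nonneg x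
    rw [signAverage_const] at this ⊢
    linarith
  -- With `v = ‖x‖ / σ` this reads `v ^ 2 - (4 / 27) * v ^ 4 ≤ v`, that is,
  -- `0 ≤ (4 / 27) * v * (v - 3 / 2) ^ 2 * (v + 3)`.
  have hpt : ∀ x : E, σ ^ 2 * ‖x‖ ^ 2 + -(4 / 27) * ‖x‖ ^ 4 ≤ σ ^ 3 * ‖x‖ := fun x => by
    have : 0 ≤ ‖x‖ * ((‖x‖ - 3 / 2 * σ) ^ 2 * (‖x‖ + 3 * σ)) := by positivity
    nlinarith [this]
  have h := signAverage_mono u n hpt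
  rw [signAverage_add, signAverage_const_mul, signAverage_const_mul, signAverage_const_mul,
    signAverage_norm_sq 𝕜, ← hσ2] at h
  have h4 := signAverage_norm_pow_four_le 𝕜 u n
  rw [← hσ2] at h4
  have h6 : σ ^ 3 * (σ * (5 / 9)) ≤ σ ^ 3 * signAverage u n (fun x => ‖x‖) := by nlinarith
  have := le_of_mul_le_mul_left h6 (by positivity)
  linarith

theorem signAverage_norm_le_sqrt (𝕜 : Type*) [RCLike 𝕜] [InnerProductSpace 𝕜 E] {u : ℕ → E}
    (hu : ∀ k, ‖u k‖ ≤ 1) (n : ℕ) : signAverage u n (fun x => ‖x‖) ≤ √n := by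
  rcases Nat.eq_zero_or_pos n with rfl | hn
  · simp [signAverage]
  have hs : 0 < √(n : ℝ) := Real.sqrt_pos.2 (by exact_mod_cast hn)
  have hs2 : √(n : ℝ) ^ 2 = n := Real.sq_sqrt (by positivity)
  have hpt : ∀ x : E, 2 * √(n : ℝ) * ‖x‖ ≤ ‖x‖ ^ 2 + n := fun x => by
    nlinarith [sq_nonneg (‖x‖ - √(n : ℝ))]
  have h := signAverage_mono u n hpt
  rw [signAverage_const_mul, signAverage_add, signAverage_const, signAverage_norm_sq 𝕜] at h
  have hsum : ∑ k ∈ Finset.range n, ‖u k‖ ^ 2 ≤ n := by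
    calc ∑ k ∈ Finset.range n, ‖u k‖ ^ 2 ≤ ∑ k ∈ Finset.range n, (1 : ℝ) :=
          Finset.sum_le_sum fun k _ => pow_le_one₀ (norm_nonneg _) (hu k)
      _ = n := by simp
  have h2 : √(n : ℝ) * signAverage u n (fun x => ‖x‖) ≤ √(n : ℝ) * √(n : ℝ) := by nlinarith
  exact le_of_mul_le_mul_left h2 hs

end SignAverage

/-! ### Power growth on Hilbert spaces -/

section HilbertPowerGrowth

variable {𝕜 : Type*} [RCLike 𝕜] {H : Type*} [NormedAddCommGroup H] [InnerProductSpace 𝕜 H]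

/-- Testing absolute Cesàro boundedness on random sums `± u 0 ± ⋯ ± u (n - 1)`, whose norm is at
most `√n` on average, gives a square function estimate. -/
theorem AbsCesaroBoundedWith.sum_sqrt_le {S : H →L[𝕜] H} {C : ℝ} (hC : 0 < C)
    (hS : AbsCesaroBoundedWith S C) {u : ℕ → H} (hu : ∀ k, ‖u k‖ ≤ 1) (N n : ℕ) :
    ∑ t ∈ Finset.range N, √(∑ k ∈ Finset.range n, ‖(S ^ t) (u k)‖ ^ 2) ≤
      2 * C * N * √n := by
  calc ∑ t ∈ Finset.range N, √(∑ k ∈ Finset.range n, ‖(S ^ t) (u k)‖ ^ 2)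
      ≤ ∑ t ∈ Finset.range N, 2 * signAverage u n (fun x => ‖(S ^ t) x‖) := by
        refine Finset.sum_le_sum fun t _ => ?_
        exact (sqrt_sum_norm_sq_le_signAverage 𝕜 (fun k => (S ^ t) (u k)) n).trans_eq
          (congrArg (2 * ·) (signAverage_comp (S ^ t).toLinearMap.toAddMonoidHom u n
            fun x => ‖x‖).symm)
    _ = 2 * signAverage u n (fun x => ∑ t ∈ Finset.range N, ‖(S ^ t) x‖) := by
        rw [signAverage_sum, Finset.mul_sum]
    _ ≤ 2 * signAverage u n (fun x => C * N * ‖x‖) := by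
        gcongr
        exact signAverage_mono u n fun x => hS N x
    _ = 2 * (C * N * signAverage u n (fun x => ‖x‖)) := by rw [signAverage_const_mul]
    _ ≤ 2 * (C * N * √n) := by
        gcongr
        exact signAverage_norm_le_sqrt 𝕜 hu n
    _ = 2 * C * N * √n := by ring

theorem exists_norm_pow_apply_ge (S : H →L[𝕜] H) :
    ∃ u : ℕ → H, (∀ k, ‖u k‖ ≤ 1) ∧ ∀ k, ‖S ^ k‖ ≤ 2 * ‖(S ^ k) (u k)‖ := by
  have h : ∀ k, ∃ x : H, ‖x‖ ≤ 1 ∧ ‖S ^ k‖ ≤ 2 * ‖(S ^ k) x‖ := fun k => by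
    by_cases h0 : ‖S ^ k‖ = 0
    · exact ⟨0, by simp, by simp [h0]⟩
    have hpos : 0 < ‖S ^ k‖ := lt_of_le_of_ne (norm_nonneg _) (Ne.symm h0)
    obtain ⟨x, hx, hlt⟩ := (S ^ k).exists_lt_apply_of_lt_opNorm (half_lt_self hpos)
    exact ⟨x, hx.le, by linarith⟩
  choose u hu using h
  exact ⟨u, fun k => (hu k).1, fun k => (hu k).2⟩

theorem AbsCesaroBoundedWith.sum_norm_pow_le {S : H →L[𝕜] H} {C : ℝ} (hC : 0 < C)
    (hS : AbsCesaroBoundedWith S C) (N : ℕ) :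
    ∑ k ∈ Finset.range N, ‖S ^ k‖ ≤ 4 * C * N * √N := by
  obtain ⟨u, hu, huS⟩ := exists_norm_pow_apply_ge S
  calc ∑ k ∈ Finset.range N, ‖S ^ k‖
      ≤ ∑ t ∈ Finset.range N, 2 * √(∑ k ∈ Finset.range N, ‖(S ^ t) (u k)‖ ^ 2) := by
        refine Finset.sum_le_sum fun t ht => (huS t).trans ?_
        gcongr
        exact Real.le_sqrt_of_sq_le (Finset.single_le_sum
          (f := fun k => ‖(S ^ t) (u k)‖ ^ 2) (fun _ _ => by positivity) ht)
    _ ≤ 2 * (2 * C * N * √N) := by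
        rw [← Finset.mul_sum]
        gcongr
        exact hS.sum_sqrt_le hC hu N N
    _ = 4 * C * N * √N := by ring

theorem AbsCesaroBoundedWith.norm_pow_le_sqrt {S : H →L[𝕜] H} {C : ℝ} (hC : 0 < C)
    (hS : AbsCesaroBoundedWith S C) (n : ℕ) : ‖S ^ n‖ ≤ 4 * C ^ 2 * √(n + 1) := by
  have h1 := hS.mul_norm_pow_le_sum hC n
  have h2 := hS.sum_norm_pow_le hC (n + 1)
  simp only [Nat.cast_add, Nat.cast_one] at h2
  have h3 := mul_le_mul_of_nonneg_left h2 hC.le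
  refine le_of_mul_le_mul_left (a := (n : ℝ) + 1) ?_ (by positivity)
  linarith

/-- The bound `‖S ^ r‖ = O(√r)` improves itself: it forces
`‖S ^ t (u (t + r))‖ ^ 2 ≥ c * ‖S ^ (t + r)‖ ^ 2 / (r + 1)` for almost norming vectors `u k` of
`S ^ k`, so that the square function of the `u k` gains a harmonic sum. -/
theorem AbsCesaroBoundedWith.sum_norm_pow_le_of_harmonic {S : H →L[𝕜] H} {C : ℝ} (hC : 0 < C)
    (hS : AbsCesaroBoundedWith S C) (N R : ℕ) (hR : 0 < R) :
    ∑ k ∈ Finset.range N, ‖S ^ k‖ ≤ ∑ k ∈ Finset.range R, ‖S ^ k‖ +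
      16 * C ^ 3 * N * √(N + R) / √(∑ j ∈ Finset.range R, 1 / ((j : ℝ) + 1)) := by
  obtain ⟨u, hu, huS⟩ := exists_norm_pow_apply_ge S
  set h := ∑ j ∈ Finset.range R, 1 / ((j : ℝ) + 1) with hh
  have hpos : 0 < h :=
    Finset.sum_pos (fun _ _ => by positivity) ⟨0, by simpa using hR⟩
  have hs : 0 < √h := Real.sqrt_pos.2 hpos
  have hs2 : √h * √h = h := Real.mul_self_sqrt hpos.le
  set A : ℕ → ℝ := fun n => ∑ k ∈ Finset.range n, ‖S ^ k‖ with hA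
  have hAmono : Monotone A := fun m n hmn =>
    Finset.sum_le_sum_of_subset_of_nonneg (Finset.range_mono hmn) fun _ _ _ => norm_nonneg _
  -- the square function at time `t` dominates the harmonically weighted norms of later powers
  have hlow : ∀ t ∈ Finset.range N, ∑ r ∈ Finset.range R, ‖S ^ (t + r)‖ * (1 / ((r : ℝ) + 1)) ≤
      8 * C ^ 2 * √h * √(∑ k ∈ Finset.range (N + R), ‖(S ^ t) (u k)‖ ^ 2) := fun t ht => by
    calc ∑ r ∈ Finset.range R, ‖S ^ (t + r)‖ * (1 / ((r : ℝ) + 1))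
        ≤ ∑ r ∈ Finset.range R, 8 * C ^ 2 * (√(1 / ((r : ℝ) + 1)) *
            √(‖(S ^ t) (u (t + r))‖ ^ 2)) := by
          refine Finset.sum_le_sum fun r _ => ?_
          have hr : (0 : ℝ) < √((r : ℝ) + 1) := Real.sqrt_pos.2 (by positivity)
          have h1 : ‖S ^ (t + r)‖ ≤ 8 * C ^ 2 * √((r : ℝ) + 1) * ‖(S ^ t) (u (t + r))‖ := by
            have h2 := norm_pow_add_apply_le S r t (u (t + r))
            rw [add_comm r t] at h2
            have h3 := mul_le_mul_of_nonneg_right (hS.norm_pow_le_sqrt hC r)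
              (norm_nonneg ((S ^ t) (u (t + r))))
            linarith [huS (t + r)]
          rw [Real.sqrt_sq (norm_nonneg _), Real.sqrt_div zero_le_one, Real.sqrt_one, mul_one_div,
            div_le_iff₀ (by positivity)]
          refine h1.trans_eq ?_
          rw [show 8 * C ^ 2 * (1 / √((r : ℝ) + 1) * ‖(S ^ t) (u (t + r))‖) * ((r : ℝ) + 1) =
            8 * C ^ 2 * (((r : ℝ) + 1) / √((r : ℝ) + 1)) * ‖(S ^ t) (u (t + r))‖ by ring,
            Real.div_sqrt]
      _ ≤ 8 * C ^ 2 * (√h * √(∑ r ∈ Finset.range R, ‖(S ^ t) (u (t + r))‖ ^ 2)) := by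
          rw [← Finset.mul_sum]
          gcongr
          exact Real.sum_sqrt_mul_sqrt_le _ (fun _ => by positivity) fun _ => by positivity
      _ ≤ 8 * C ^ 2 * (√h * √(∑ k ∈ Finset.range (N + R), ‖(S ^ t) (u k)‖ ^ 2)) := by
          gcongr
          calc ∑ r ∈ Finset.range R, ‖(S ^ t) (u (t + r))‖ ^ 2
              ≤ ∑ k ∈ Finset.range (t + R), ‖(S ^ t) (u k)‖ ^ 2 := by
                rw [Finset.sum_range_add]
                exact le_add_of_nonneg_left (Finset.sum_nonneg fun _ _ => by positivity)
            _ ≤ _ := Finset.sum_le_sum_of_subset_of_nonneg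
                (Finset.range_mono (by have := Finset.mem_range.1 ht; omega))
                fun _ _ _ => by positivity
      _ = _ := by ring
  have hup : ∑ t ∈ Finset.range N, ∑ r ∈ Finset.range R, ‖S ^ (t + r)‖ * (1 / ((r : ℝ) + 1)) ≤
      8 * C ^ 2 * √h * (2 * C * N * √(N + R)) := by
    refine (Finset.sum_le_sum hlow).trans ?_
    rw [← Finset.mul_sum]
    gcongr
    simpa only [Nat.cast_add] using hS.sum_sqrt_le hC hu N (N + R)
  have hswap : h * (A N - A R) ≤
      ∑ t ∈ Finset.range N, ∑ r ∈ Finset.range R, ‖S ^ (t + r)‖ * (1 / ((r : ℝ) + 1)) := by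
    rw [Finset.sum_comm, hh, Finset.sum_mul]
    refine Finset.sum_le_sum fun r hr => ?_
    rw [← Finset.sum_mul, mul_comm]
    gcongr
    have h1 : A (r + N) = A r + ∑ t ∈ Finset.range N, ‖S ^ (t + r)‖ := by
      simp only [hA, Finset.sum_range_add]
      exact congrArg _ (Finset.sum_congr rfl fun t _ => by rw [add_comm])
    have h2 := hAmono (Finset.mem_range.1 hr).le
    have h3 := hAmono (Nat.le_add_left N r)
    linarith
  have hfin : √h * (A N - A R) ≤ 16 * C ^ 3 * N * √(N + R) := by
    refine le_of_mul_le_mul_left (a := √h) ?_ hs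
    calc √h * (√h * (A N - A R)) = h * (A N - A R) := by rw [← mul_assoc, hs2]
      _ ≤ 8 * C ^ 2 * √h * (2 * C * N * √(N + R)) := hswap.trans hup
      _ = _ := by ring
  have := (le_div_iff₀' hs).2 hfin
  change A N ≤ A R + _
  linarith

/-- On an inner product space, an absolutely Cesàro bounded operator has powers of norm
`o(√n)`. -/
theorem AbsCesaroBoundedWith.tendsto_norm_pow_div_sqrt {S : H →L[𝕜] H} {C : ℝ} (hC : 0 < C)
    (hS : AbsCesaroBoundedWith S C) :
    Tendsto (fun n : ℕ => ‖S ^ n‖ / √(n : ℝ)) atTop (𝓝 0) := by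
  have hsqrt : Tendsto (fun R : ℕ => √(∑ j ∈ Finset.range R, 1 / ((j : ℝ) + 1))) atTop atTop :=
    Real.tendsto_sqrt_atTop.comp Real.tendsto_sum_range_one_div_nat_succ_atTop
  have hlim := Tendsto.const_div_atTop hsqrt (64 * C ^ 4)
  rw [Metric.tendsto_atTop]
  intro ε hε
  -- a long window `R` makes the main term small; the sum over the first `R` powers is then a
  -- constant, negligible for large `n`
  obtain ⟨R, hR, hR0⟩ := ((hlim.eventually (gt_mem_nhds (half_pos hε))).and
    (eventually_gt_atTop 0)).exists
  set s := √(∑ j ∈ Finset.range R, 1 / ((j : ℝ) + 1)) with hs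
  have hs0 : 0 < s := Real.sqrt_pos.2 <|
    Finset.sum_pos (fun _ _ => by positivity) ⟨0, by simpa using hR0⟩
  set B := C * ∑ k ∈ Finset.range R, ‖S ^ k‖ with hB
  have hB0 : 0 ≤ B := mul_nonneg hC.le (Finset.sum_nonneg fun _ _ => norm_nonneg _)
  obtain ⟨M, hM⟩ := exists_nat_gt (B / (ε / 2))
  refine ⟨max M (max R 1), fun n hn => ?_⟩
  have hnM : M ≤ n := (le_max_left _ _).trans hn
  have hnR : (R : ℝ) ≤ n := by
    exact_mod_cast (le_max_left _ _).trans ((le_max_right _ _).trans hn)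
  have hn1 : (1 : ℝ) ≤ n := by
    exact_mod_cast (le_max_right _ _).trans ((le_max_right _ _).trans hn)
  have hq : 1 ≤ √(n : ℝ) := Real.one_le_sqrt.2 hn1
  have hBn : B < ε / 2 * n := by
    rw [div_lt_iff₀' (by positivity)] at hM
    exact hM.trans_le (by gcongr)
  have h1 := hS.mul_norm_pow_le_sum hC n
  have h2 := mul_le_mul_of_nonneg_left (hS.sum_norm_pow_le_of_harmonic hC (n + 1) R hR0) hC.le
  rw [mul_add, ← hB, ← hs] at h2
  have hroot : √(((n + 1 : ℕ) : ℝ) + R) ≤ 2 * √(n : ℝ) := by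
    rw [Real.sqrt_le_left (by positivity), mul_pow, Real.sq_sqrt (by positivity)]
    push_cast
    linarith
  have h3 : C * (16 * C ^ 3 * ((n + 1 : ℕ) : ℝ) * √(((n + 1 : ℕ) : ℝ) + R) / s) ≤
      (n + 1) * (32 * C ^ 4 / s * √(n : ℝ)) := by
    calc C * (16 * C ^ 3 * ((n + 1 : ℕ) : ℝ) * √(((n + 1 : ℕ) : ℝ) + R) / s)
        ≤ C * (16 * C ^ 3 * ((n + 1 : ℕ) : ℝ) * (2 * √(n : ℝ)) / s) := by gcongr
      _ = _ := by
        push_cast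
        ring
  have h4 : (64 * C ^ 4 / s) = 2 * (32 * C ^ 4 / s) := by ring
  have h5 : 0 ≤ 32 * C ^ 4 / s := by positivity
  have h6 : ((n : ℝ) + 1) * ‖S ^ n‖ < (n + 1) * (ε * √(n : ℝ)) := by
    calc ((n : ℝ) + 1) * ‖S ^ n‖ ≤ B + (n + 1) * (32 * C ^ 4 / s * √(n : ℝ)) := by linarith
      _ < (n + 1) * (ε / 2 * √(n : ℝ)) + (n + 1) * (ε / 2 * √(n : ℝ)) := by
        refine add_lt_add_of_lt_of_le ?_ ?_
        · refine hBn.trans_le ?_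
          nlinarith [mul_nonneg hε.le (sub_nonneg.2 hq), mul_pos hε (by linarith : (0 : ℝ) < n)]
        · have h7 : 32 * C ^ 4 / s ≤ ε / 2 := by linarith
          gcongr
      _ = _ := by ring
  rw [Real.dist_eq, sub_zero, abs_of_nonneg (by positivity), div_lt_iff₀ (by positivity)]
  exact lt_of_mul_lt_mul_left h6 (by positivity)

end HilbertPowerGrowth

namespace C0Semigroup

variable {𝕜 : Type*} [RCLike 𝕜] {X : Type*} [NormedAddCommGroup X] [NormedSpace 𝕜 X]

/-! ### Cesàro means as seminorms -/

section Mean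

theorem continuous_op (T : C0Semigroup 𝕜 X) (x : X) : Continuous fun t : ℝ≥0 => T.op t x :=
  continuous_iff_continuousAt.2 (T.tendsto_op x)

theorem continuous_norm_op (T : C0Semigroup 𝕜 X) (x : X) :
    Continuous fun t : ℝ => ‖T.op t.toNNReal x‖ :=
  ((T.continuous_op x).comp continuous_real_toNNReal).norm

theorem op_add_apply (T : C0Semigroup 𝕜 X) (t s : ℝ≥0) (x : X) :
    T.op (t + s) x = T.op t (T.op s x) := by
  rw [← T.op_comp]
  rfl

theorem mean_nonneg (T : C0Semigroup 𝕜 X) (x : X) {b : ℝ} (hb : 0 ≤ b) : 0 ≤ T.mean x b :=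
  mul_nonneg (by positivity) (intervalIntegral.integral_nonneg hb fun _ _ => norm_nonneg _)

theorem mean_zero (T : C0Semigroup 𝕜 X) (b : ℝ) : T.mean 0 b = 0 := by
  simp [mean]

theorem mean_smul (T : C0Semigroup 𝕜 X) (c : 𝕜) (x : X) (b : ℝ) :
    T.mean (c • x) b = ‖c‖ * T.mean x b := by
  simp only [mean, map_smul, norm_smul, intervalIntegral.integral_const_mul]
  ring

theorem mean_add_le (T : C0Semigroup 𝕜 X) (x y : X) {b : ℝ} (hb : 0 ≤ b) :
    T.mean (x + y) b ≤ T.mean x b + T.mean y b := by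
  have hx := (T.continuous_norm_op x).intervalIntegrable (μ := MeasureTheory.volume) 0 b
  have hy := (T.continuous_norm_op y).intervalIntegrable (μ := MeasureTheory.volume) 0 b
  rw [mean, mean, mean, ← mul_add, ← intervalIntegral.integral_add hx hy]
  refine mul_le_mul_of_nonneg_left (intervalIntegral.integral_mono_on hb
    ((T.continuous_norm_op (x + y)).intervalIntegrable 0 b) (hx.add hy) fun t _ => ?_)
    (by positivity)
  rw [map_add]
  exact norm_add_le _ _

theorem mean_le_mean_add_mean_sub (T : C0Semigroup 𝕜 X) (x y : X) {b : ℝ} (hb : 0 ≤ b) :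
    T.mean x b ≤ T.mean y b + T.mean (x - y) b := by
  simpa using T.mean_add_le y (x - y) hb

theorem mean_sum_le (T : C0Semigroup 𝕜 X) {ι : Type*} (s : Finset ι) (f : ι → X) {b : ℝ}
    (hb : 0 ≤ b) : T.mean (∑ i ∈ s, f i) b ≤ ∑ i ∈ s, T.mean (f i) b :=
  Finset.le_sum_of_subadditive (fun x => T.mean x b) (T.mean_zero b).le
    (fun x y => T.mean_add_le x y hb) s f

variable [CompleteSpace X]

/-- By the uniform boundedness principle, a `C₀`-semigroup is bounded on compact intervals. -/
theorem exists_norm_op_le (T : C0Semigroup 𝕜 X) (B : ℝ≥0) :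
    ∃ M, 0 < M ∧ ∀ t ≤ B, ‖T.op t‖ ≤ M := by
  obtain ⟨M, hM⟩ := banach_steinhaus (g := fun t : Set.Icc (0 : ℝ≥0) B => T.op t) fun x => by
    obtain ⟨C, hC⟩ := (isCompact_Icc (a := (0 : ℝ≥0)) (b := B)).exists_bound_of_continuousOn
      (T.continuous_op x).continuousOn
    exact ⟨C, fun t => hC t t.2⟩
  exact ⟨max M 1, by positivity, fun t ht => (hM ⟨t, zero_le, ht⟩).trans (le_max_left _ _)⟩

theorem exists_mean_le (T : C0Semigroup 𝕜 X) (B : ℝ) :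
    ∃ M, 1 ≤ M ∧ ∀ b, 0 < b → b ≤ B → ∀ x, T.mean x b ≤ M * ‖x‖ := by
  obtain ⟨M, hM0, hM⟩ := T.exists_norm_op_le B.toNNReal
  refine ⟨max M 1, le_max_right _ _, fun b hb hbB x => ?_⟩
  rw [mean, one_div_mul_eq_div, div_le_iff₀ hb]
  calc ∫ t in (0 : ℝ)..b, ‖T.op t.toNNReal x‖ ≤ ∫ _ in (0 : ℝ)..b, max M 1 * ‖x‖ := by
        refine intervalIntegral.integral_mono_on hb.le
          ((T.continuous_norm_op x).intervalIntegrable 0 b) (by simp) fun t ht => ?_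
        refine (T.op t.toNNReal).le_of_opNorm_le ((hM _ ?_).trans (le_max_left _ _)) x
        exact Real.toNNReal_le_toNNReal (ht.2.trans hbB)
    _ = max M 1 * ‖x‖ * b := by
        rw [intervalIntegral.integral_const, smul_eq_mul]
        ring

theorem continuous_mean (T : C0Semigroup 𝕜 X) {b : ℝ} (hb : 0 < b) :
    Continuous fun x => T.mean x b := by
  obtain ⟨M, hM1, hM⟩ := T.exists_mean_le b
  refine (LipschitzWith.of_le_add_mul M.toNNReal fun x y => ?_).continuous
  rw [Real.coe_toNNReal _ (zero_le_one.trans hM1), dist_eq_norm]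
  exact (T.mean_le_mean_add_mean_sub x y hb.le).trans (by grw [hM b hb le_rfl (x - y)])

theorem mean_le_of_hasSum (T : C0Semigroup 𝕜 X) {f : ℕ → X} {x : X} {g : ℕ → ℝ} {G b : ℝ}
    (hb : 0 < b) (hf : HasSum f x) (hg : HasSum g G) (h : ∀ k, T.mean (f k) b ≤ g k) :
    T.mean x b ≤ G :=
  le_of_tendsto_of_tendsto' (((T.continuous_mean hb).tendsto x).comp hf) hg fun s =>
    (T.mean_sum_le s f hb.le).trans (Finset.sum_le_sum fun k _ => h k)

end Mean

/-! ### Vectors with null means and equicontinuity -/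

section MeanNull

/-- The subspace of vectors whose Cesàro means tend to `0`. -/
def meanNull (T : C0Semigroup 𝕜 X) : Submodule 𝕜 X where
  carrier := {x | Tendsto (fun b : ℝ => T.mean x b) atTop (𝓝 0)}
  zero_mem' := by simp [mean_zero]
  add_mem' {x y} hx hy := by
    have h := Tendsto.add hx hy
    rw [add_zero] at h
    refine squeeze_zero' ?_ ?_ h
    · filter_upwards [eventually_ge_atTop 0] with b hb using T.mean_nonneg _ hb
    · filter_upwards [eventually_ge_atTop 0] with b hb using T.mean_add_le x y hb
  smul_mem' c x hx := by
    have h := Tendsto.const_mul ‖c‖ hx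
    rw [mul_zero] at h
    exact h.congr fun b => (T.mean_smul c x b).symm

/-- The Cesàro mean seminorms `x ↦ T.mean x b`, `b ≥ 1`, are equicontinuous. -/
def IsMeanBounded (T : C0Semigroup 𝕜 X) : Prop :=
  ∃ C, 0 < C ∧ ∀ b, 1 ≤ b → ∀ x, T.mean x b ≤ C * ‖x‖

theorem IsMeanBounded.tendsto_mean {T : C0Semigroup 𝕜 X} (hT : T.IsMeanBounded)
    (hdense : Dense (T.meanNull : Set X)) (x : X) :
    Tendsto (fun b : ℝ => T.mean x b) atTop (𝓝 0) := by
  obtain ⟨C, hC, h⟩ := hT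
  rw [Metric.tendsto_atTop]
  intro ε hε
  obtain ⟨y, hy, hxy⟩ := hdense.exists_dist_lt x (ε := ε / 2 / C) (by positivity)
  obtain ⟨B, hB⟩ := eventually_atTop.1 (Tendsto.eventually_lt_const (half_pos hε) hy)
  refine ⟨max B 1, fun b hb => ?_⟩
  have hb1 : 1 ≤ b := (le_max_right _ _).trans hb
  rw [Real.dist_eq, sub_zero, abs_of_nonneg (T.mean_nonneg x (by linarith))]
  rw [dist_eq_norm, lt_div_iff₀' hC] at hxy
  linarith [T.mean_le_mean_add_mean_sub x y (by linarith : 0 ≤ b), h b hb1 (x - y),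
    hB b ((le_max_left _ _).trans hb)]

theorem not_isMeanBounded_of_limsup_mean_pos {T : C0Semigroup 𝕜 X}
    (hdense : Dense (T.meanNull : Set X)) {y : X}
    (hy : 0 < limsup (fun b : ℝ => (T.mean y b : EReal)) atTop) : ¬ T.IsMeanBounded := fun h => by
  have := ((continuous_coe_real_ereal.tendsto 0).comp (h.tendsto_mean hdense y)).limsup_eq
  simp only [Function.comp_def] at this
  rw [this] at hy
  exact lt_irrefl _ hy

end MeanNull

/-! ### Equicontinuity of the means restricts the growth of the semigroup -/

section Growth

theorem op_natCast (T : C0Semigroup 𝕜 X) (n : ℕ) : T.op n = T.op 1 ^ n := by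
  induction n with
  | zero => rw [Nat.cast_zero, T.op_zero, pow_zero]; rfl
  | succ n ih => rw [Nat.cast_succ, ← T.op_comp, ih, pow_succ]; rfl

variable [CompleteSpace X]

theorem IsMeanBounded.exists_absCesaroBoundedWith {T : C0Semigroup 𝕜 X} (hT : T.IsMeanBounded) :
    ∃ C, 0 < C ∧ AbsCesaroBoundedWith (T.op 1) C := by
  obtain ⟨C, hC, h⟩ := hT
  obtain ⟨M, hM0, hM⟩ := T.exists_norm_op_le 1
  have hint : ∀ (x : X) (a b : ℝ), IntervalIntegrable (fun t : ℝ => ‖T.op t.toNNReal x‖)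
      MeasureTheory.volume a b := fun x a b => (T.continuous_norm_op x).intervalIntegrable a b
  -- `T_{n + 1} x = T_{n + 1 - t} (T_t x)` for `t ∈ [n, n + 1]`, where `‖T_{n + 1 - t}‖ ≤ M`
  have hstep : ∀ (n : ℕ) (x : X), ‖(T.op 1 ^ (n + 1)) x‖ ≤
      M * ∫ t in (n : ℝ)..(n + 1 : ℕ), ‖T.op t.toNNReal x‖ := fun n x => by
    rw [← intervalIntegral.integral_const_mul]
    calc ‖(T.op 1 ^ (n + 1)) x‖ = ∫ _ in (n : ℝ)..(n + 1 : ℕ), ‖(T.op 1 ^ (n + 1)) x‖ := by simp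
      _ ≤ _ := by
        refine intervalIntegral.integral_mono_on (by simp) (by simp) ((hint x _ _).const_mul M)
          fun t ht => ?_
        have ht0 : 0 ≤ t := (Nat.cast_nonneg n).trans ht.1
        have hle : t.toNNReal ≤ ((n + 1 : ℕ) : ℝ≥0) := Real.toNNReal_le_iff_le_coe.2 (by
          simpa using ht.2)
        have hsplit : ((n + 1 : ℕ) : ℝ≥0) = (((n + 1 : ℕ) : ℝ≥0) - t.toNNReal) + t.toNNReal :=
          (tsub_add_cancel_of_le hle).symm
        rw [← T.op_natCast, hsplit, T.op_add_apply]
        refine (T.op _).le_of_opNorm_le (hM _ ?_) _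
        rw [tsub_le_iff_right, ← NNReal.coe_le_coe]
        have := ht.1
        push_cast
        rw [Real.coe_toNNReal t ht0]
        linarith
  have hsum : ∀ (N : ℕ) (x : X), ∑ n ∈ Finset.range (N + 1), ‖(T.op 1 ^ n) x‖ ≤
      ‖x‖ + M * ∫ t in (0 : ℝ)..N, ‖T.op t.toNNReal x‖ := fun N x => by
    induction N with
    | zero => simp
    | succ N ih =>
      rw [Finset.sum_range_succ, ← intervalIntegral.integral_add_adjacent_intervals
        (hint x 0 N) (hint x N _), mul_add]
      linarith [hstep N x]
  refine ⟨1 + M * C, by positivity, fun N x => ?_⟩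
  rcases Nat.eq_zero_or_pos N with rfl | hN
  · simp
  have hN1 : (1 : ℝ) ≤ N := by exact_mod_cast hN
  have h1 := h N hN1 x
  rw [mean, one_div_mul_eq_div, div_le_iff₀ (by positivity)] at h1
  have h2 : ∑ n ∈ Finset.range N, ‖(T.op 1 ^ n) x‖ ≤
      ∑ n ∈ Finset.range (N + 1), ‖(T.op 1 ^ n) x‖ :=
    Finset.sum_le_sum_of_subset_of_nonneg (Finset.range_mono N.le_succ) fun _ _ _ => norm_nonneg _
  have h3 := mul_le_mul_of_nonneg_left h1 hM0.le
  have h4 : ‖x‖ ≤ N * ‖x‖ := le_mul_of_one_le_left (norm_nonneg x) hN1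
  calc _ ≤ _ := h2.trans (hsum N x)
    _ ≤ N * ‖x‖ + M * (C * ‖x‖ * N) := add_le_add h4 h3
    _ = (1 + M * C) * N * ‖x‖ := by ring

theorem exists_norm_op_le_norm_pow_floor (T : C0Semigroup 𝕜 X) :
    ∃ M, 0 < M ∧ ∀ t : ℝ≥0, ‖T.op t‖ ≤ M * ‖T.op 1 ^ ⌊t⌋₊‖ := by
  obtain ⟨M, hM0, hM⟩ := T.exists_norm_op_le 1
  refine ⟨M, hM0, fun t => ?_⟩
  have hsplit : (t - (⌊t⌋₊ : ℝ≥0)) + (⌊t⌋₊ : ℝ≥0) = t :=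
    tsub_add_cancel_of_le (Nat.floor_le zero_le)
  nth_rewrite 1 [← hsplit]
  rw [← T.op_comp, ← T.op_natCast]
  refine (ContinuousLinearMap.opNorm_comp_le _ _).trans ?_
  gcongr
  refine hM _ ?_
  rw [tsub_le_iff_left]
  exact (Nat.lt_floor_add_one t).le

/-- Growth bounds for the powers of `T.op 1` pass to the semigroup. -/
theorem tendsto_norm_op_div (T : C0Semigroup 𝕜 X) {g : ℝ → ℝ} (hg : Monotone g)
    (hg1 : ∀ t, 1 ≤ t → 0 < g t)
    (h : Tendsto (fun n : ℕ => ‖T.op 1 ^ n‖ / g n) atTop (𝓝 0)) :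
    Tendsto (fun t : ℝ≥0 => ‖T.op t‖ / g t) atTop (𝓝 0) := by
  obtain ⟨M, hM0, hM⟩ := T.exists_norm_op_le_norm_pow_floor
  have hlim := (h.comp (tendsto_nat_floor_atTop (α := ℝ≥0))).const_mul M
  rw [mul_zero] at hlim
  refine squeeze_zero' ?_ ?_ hlim
  · filter_upwards [eventually_ge_atTop 1] with t ht
    exact div_nonneg (norm_nonneg _) (hg1 t (by exact_mod_cast ht)).le
  · filter_upwards [eventually_ge_atTop 1] with t ht
    have hfloor : (1 : ℝ) ≤ (⌊t⌋₊ : ℕ) := by exact_mod_cast Nat.one_le_floor_iff t |>.2 ht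
    have hle : ((⌊t⌋₊ : ℕ) : ℝ) ≤ t := by exact_mod_cast Nat.floor_le (zero_le (a := t))
    rw [Function.comp_apply, ← mul_div_assoc]
    exact div_le_div₀ (by positivity) (hM t) (hg1 _ hfloor) (hg hle)

theorem not_isMeanBounded_of_limsup_norm_op_div_pos {T : C0Semigroup 𝕜 X}
    (h : 0 < limsup (fun t : ℝ≥0 => ((‖T.op t‖ / (t : ℝ) : ℝ) : EReal)) atTop) :
    ¬ T.IsMeanBounded := fun hT => by
  obtain ⟨C, hC, hS⟩ := hT.exists_absCesaroBoundedWith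
  have hlim := T.tendsto_norm_op_div (g := fun t => t) monotone_id (fun t ht => by linarith)
    (hS.tendsto_norm_pow_div hC)
  have := ((continuous_coe_real_ereal.tendsto 0).comp hlim).limsup_eq
  simp only [Function.comp_def] at this
  rw [this] at h
  exact lt_irrefl _ h

theorem not_isMeanBounded_of_limsup_norm_op_div_sqrt_pos {T : C0Semigroup 𝕜 X}
    (hX : NormFromInner 𝕜 X)
    (h : 0 < limsup (fun t : ℝ≥0 => ((‖T.op t‖ / √(t : ℝ) : ℝ) : EReal)) atTop) :
    ¬ T.IsMeanBounded := fun hT => by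
  obtain ⟨I, rfl⟩ := hX
  obtain ⟨C, hC, hS⟩ := hT.exists_absCesaroBoundedWith
  have hlim := T.tendsto_norm_op_div (g := fun t => √t) (fun _ _ => Real.sqrt_le_sqrt)
    (fun t ht => Real.sqrt_pos.2 (by linarith)) (hS.tendsto_norm_pow_div_sqrt hC)
  have := ((continuous_coe_real_ereal.tendsto 0).comp hlim).limsup_eq
  simp only [Function.comp_def] at this
  rw [this] at h
  exact lt_irrefl _ h

end Growth

/-! ### Eigenvectors of the generator -/

section Eigenvector

/-- Along an eigenvector of the generator whose eigenvalue has nonnegative real part, the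
right lower derivative of `t ↦ ‖T.op t x‖` is nonnegative. -/
theorem HasGeneratorValue.norm_le_norm_op {T : C0Semigroup 𝕜 X} {x : X} {μ : 𝕜}
    (hx : T.HasGeneratorValue x (μ • x)) (hμ : 0 ≤ RCLike.re μ) {t : ℝ} (ht : 0 ≤ t) :
    ‖x‖ ≤ ‖T.op t.toNNReal x‖ := by
  have key := image_le_of_liminf_slope_right_le_deriv_boundary (a := 0) (b := t)
    (f := fun s => -‖T.op s.toNNReal x‖) (B := fun _ => -‖x‖) (B' := fun _ => 0)
    (T.continuous_norm_op x).neg.continuousOn (by simp [T.op_zero]) continuousOn_const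
    (fun s _ => hasDerivWithinAt_const _ _ _) ?_ ⟨ht, le_rfl⟩
  · exact neg_le_neg_iff.1 key
  intro s hs r hr
  refine Eventually.frequently ?_
  have hsub : Tendsto (fun z : ℝ => (z - s).toNNReal) (𝓝[>] s) (𝓝[>] 0) := by
    refine tendsto_nhdsWithin_iff.2 ⟨?_, ?_⟩
    · have : Tendsto (fun z : ℝ => (z - s).toNNReal) (𝓝 s) (𝓝 (s - s).toNNReal) :=
        (continuous_real_toNNReal.comp (continuous_id.sub continuous_const)).tendsto s
      rw [sub_self, Real.toNNReal_zero] at this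
      exact this.mono_left nhdsWithin_le_nhds
    · filter_upwards [self_mem_nhdsWithin] with z hz
      exact Real.toNNReal_pos.2 (sub_pos.2 hz)
  have hlim := ((hx.comp hsub).sub_const (μ • x)).norm.const_mul ‖T.op s.toNNReal‖
  simp only [sub_self, norm_zero, mul_zero, Function.comp_apply] at hlim
  filter_upwards [hlim.eventually_lt_const hr, self_mem_nhdsWithin] with z hz hsz
  have hh : 0 < z - s := sub_pos.2 hsz
  set h : ℝ≥0 := (z - s).toNNReal with hdef
  have hcoe : (h : ℝ) = z - s := Real.coe_toNNReal _ hh.le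
  have hh0 : ((h : ℝ) : 𝕜) ≠ 0 := by
    rw [hcoe]
    exact_mod_cast hh.ne'
  -- the error `e` of the difference quotient tends to `0` with `h`, and
  -- `T_h x = (1 + h μ) x + h e` with `‖1 + h μ‖ ≥ 1`
  set e : X := ((h : ℝ) : 𝕜)⁻¹ • (T.op h x - x) - μ • x with he
  have hz' : z.toNNReal = s.toNNReal + h := by
    rw [hdef, ← Real.toNNReal_add hs.1 hh.le, add_sub_cancel]
  have hexp : T.op z.toNNReal x =
      (1 + ((h : ℝ) : 𝕜) * μ) • T.op s.toNNReal x + ((h : ℝ) : 𝕜) • T.op s.toNNReal e := by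
    rw [hz', T.op_add_apply, ← map_smul, ← map_smul, ← map_add]
    congr 1
    rw [he, smul_sub, smul_inv_smul₀ hh0, add_smul, one_smul, mul_smul]
    abel
  have hone : 1 ≤ ‖1 + ((h : ℝ) : 𝕜) * μ‖ := by
    refine le_trans ?_ (RCLike.re_le_norm _)
    rw [map_add, RCLike.one_re, RCLike.re_ofReal_mul]
    exact le_add_of_nonneg_right (mul_nonneg h.coe_nonneg hμ)
  have h1 : ‖T.op s.toNNReal x‖ - (z - s) * (‖T.op s.toNNReal‖ * ‖e‖) ≤ ‖T.op z.toNNReal x‖ := by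
    rw [hexp]
    refine le_trans ?_ (norm_sub_le_norm_add _ _)
    refine sub_le_sub ?_ ?_
    · rw [norm_smul]
      exact le_mul_of_one_le_left (norm_nonneg _) hone
    · rw [norm_smul, RCLike.norm_ofReal, abs_of_nonneg h.coe_nonneg, hcoe]
      gcongr
      exact (T.op _).le_opNorm e
  rw [slope_def_field, div_lt_iff₀ hh]
  have h2 := mul_lt_mul_of_pos_right hz hh
  linarith

theorem limsup_mean_pos_of_mem_pointSpectrum {T : C0Semigroup 𝕜 X} {μ : 𝕜}
    (hμ : μ ∈ T.generator.pointSpectrum) (hre : 0 ≤ RCLike.re μ) :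
    ∃ y : X, 0 < limsup (fun b : ℝ => (T.mean y b : EReal)) atTop := by
  obtain ⟨x, hx0, hx⟩ := hμ
  have hgen : T.HasGeneratorValue x (μ • (x : X)) := hx ▸ x.2.choose_spec
  refine ⟨x, lt_of_lt_of_le (b := ((‖(x : X)‖ : ℝ) : EReal)) ?_ ?_⟩
  · exact_mod_cast norm_pos_iff.2 hx0
  refine le_limsup_of_frequently_le' (Eventually.frequently ?_)
  filter_upwards [eventually_gt_atTop 0] with b hb
  rw [EReal.coe_le_coe_iff, mean, one_div_mul_eq_div, le_div_iff₀ hb]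
  calc ‖(x : X)‖ * b = ∫ _ in (0 : ℝ)..b, ‖(x : X)‖ := by
        rw [intervalIntegral.integral_const, smul_eq_mul]
        ring
    _ ≤ _ := intervalIntegral.integral_mono_on hb.le (by simp)
        ((T.continuous_norm_op _).intervalIntegrable 0 b)
        fun t ht => hgen.norm_le_norm_op hre ht.1

end Eigenvector

/-! ### Residuality -/

section Residual

theorem IsAbsMeanIrregular.of_forall_nat {T : C0Semigroup 𝕜 X} {x : X}
    (hlow : ∀ n : ℕ, ∃ b : ℝ, (n : ℝ) + 1 ≤ b ∧ T.mean x b < 1 / ((n : ℝ) + 1))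
    (hupp : ∀ n : ℕ, ∃ b : ℝ, (n : ℝ) + 1 ≤ b ∧ n < T.mean x b) : T.IsAbsMeanIrregular x := by
  refine ⟨le_antisymm ?_ ?_, EReal.eq_top_iff_forall_lt _ |>.2 fun y => ?_⟩
  · by_contra! hpos
    obtain ⟨r, hr0, hr⟩ := EReal.lt_iff_exists_real_btwn.1 hpos
    obtain ⟨B, hB⟩ := eventually_atTop.1 (eventually_lt_of_lt_liminf hr)
    have hr0' : 0 < r := by exact_mod_cast hr0
    obtain ⟨n, hn⟩ := exists_nat_one_div_lt hr0'
    obtain ⟨m, hm⟩ := exists_nat_gt B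
    obtain ⟨b, hb, hbx⟩ := hlow (max n m)
    have hmb : (m : ℝ) ≤ (max n m : ℕ) := by exact_mod_cast le_max_right n m
    have hnb : (n : ℝ) ≤ (max n m : ℕ) := by exact_mod_cast le_max_left n m
    have h1 := hB b (by linarith)
    rw [EReal.coe_lt_coe_iff] at h1
    have h2 := one_div_le_one_div_of_le (by positivity) (add_le_add_left hnb 1)
    linarith
  · refine le_liminf_of_le (by isBoundedDefault) ?_
    filter_upwards [eventually_ge_atTop 0] with b hb
    exact_mod_cast T.mean_nonneg x hb
  · refine lt_of_lt_of_le (b := ((y + 1 : ℝ) : EReal)) (by exact_mod_cast lt_add_one y) ?_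
    refine le_limsup_of_frequently_le' (frequently_atTop.2 fun B => ?_)
    obtain ⟨n, hn⟩ := exists_nat_gt (max (y + 1) B)
    obtain ⟨b, hb, hbx⟩ := hupp n
    have h1 := le_max_left (y + 1) B
    have h2 := le_max_right (y + 1) B
    refine ⟨b, by linarith, ?_⟩
    rw [EReal.coe_le_coe_iff]
    linarith

variable [CompleteSpace X]

/-- If the seminorms `T.mean · b` are not equicontinuous, then arbitrarily small vectors whose means
tend to `0` have arbitrarily large means at arbitrarily late times. -/
theorem exists_small_mem_meanNull {T : C0Semigroup 𝕜 X} (hdense : Dense (T.meanNull : Set X))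
    (hT : ¬ T.IsMeanBounded) {δ : ℝ} (hδ : 0 < δ) (K B : ℝ) :
    ∃ u ∈ T.meanNull, ‖u‖ < δ ∧ ∃ b, B ≤ b ∧ K < T.mean u b := by
  by_contra! hcon
  apply hT
  -- by density the bound on small vectors with null means extends to all small vectors
  have hball : ∀ b, max B 1 ≤ b → ∀ u, ‖u‖ < δ → T.mean u b ≤ K := fun b hb u hu => by
    by_contra! hlt
    have hb1 : 0 < b := zero_lt_one.trans_le ((le_max_right _ _).trans hb)
    have hopen : IsOpen {v : X | ‖v‖ < δ ∧ K < T.mean v b} :=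
      (isOpen_lt continuous_norm continuous_const).inter
        (isOpen_lt continuous_const (T.continuous_mean hb1))
    obtain ⟨v, ⟨hv, hvK⟩, hvn⟩ := hdense.inter_open_nonempty _ hopen ⟨u, hu, hlt⟩
    exact absurd hvK (hcon v hvn hv b ((le_max_left _ _).trans hb)).not_gt
  obtain ⟨M, hM1, hM⟩ := T.exists_mean_le (max B 1)
  refine ⟨max M (2 * K / δ), lt_max_of_lt_left (by linarith), fun b hb x => ?_⟩
  rcases le_total b (max B 1) with hbB | hbB
  · exact (hM b (by linarith) hbB x).trans (by gcongr; exact le_max_left _ _)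
  rcases eq_or_ne x 0 with rfl | hx
  · simp [mean_zero]
  have hx0 : 0 < ‖x‖ := norm_pos_iff.2 hx
  have hc : ‖((δ / 2 / ‖x‖ : ℝ) : 𝕜)‖ = δ / 2 / ‖x‖ := by
    rw [RCLike.norm_ofReal, abs_of_pos (by positivity)]
  have h := hball b hbB (((δ / 2 / ‖x‖ : ℝ) : 𝕜) • x) (by
    rw [norm_smul, hc, div_mul_cancel₀ _ hx0.ne']
    exact half_lt_self hδ)
  rw [mean_smul, hc, div_mul_eq_mul_div, div_le_iff₀ hx0] at h
  calc T.mean x b ≤ 2 * K / δ * ‖x‖ := by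
        rw [div_mul_eq_mul_div, le_div_iff₀ hδ]
        linarith
    _ ≤ _ := by gcongr; exact le_max_right _ _

theorem isAbsMeanIrregular_mem_residual {T : C0Semigroup 𝕜 X}
    (hdense : Dense (T.meanNull : Set X)) (hT : ¬ T.IsMeanBounded) :
    {x : X | T.IsAbsMeanIrregular x} ∈ residual X := by
  have hpos : ∀ (n : ℕ) (b : ℝ), (n : ℝ) + 1 ≤ b → 0 < b := fun n b hb => by
    have := n.cast_nonneg (α := ℝ)
    linarith
  have hlow : ∀ n : ℕ, {x : X | ∃ b : ℝ, (n : ℝ) + 1 ≤ b ∧ T.mean x b < 1 / ((n : ℝ) + 1)} ∈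
      residual X := fun n => by
    refine residual_of_dense_open ?_ (hdense.mono fun x hx => ?_)
    · simp only [Set.ofPred_exists, Set.ofPred_and]
      refine isOpen_iUnion fun b => ?_
      by_cases hb : (n : ℝ) + 1 ≤ b
      · simpa [hb] using isOpen_lt (T.continuous_mean (hpos n b hb)) continuous_const
      · simp [hb]
    · exact ((eventually_ge_atTop ((n : ℝ) + 1)).and
        (Tendsto.eventually_lt_const (by positivity : (0 : ℝ) < 1 / ((n : ℝ) + 1)) hx)).exists
  have hupp : ∀ n : ℕ, {x : X | ∃ b : ℝ, (n : ℝ) + 1 ≤ b ∧ n < T.mean x b} ∈ residual X :=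
      fun n => by
    refine residual_of_dense_open ?_ (Metric.dense_iff.2 fun x r hr => ?_)
    · simp only [Set.ofPred_exists, Set.ofPred_and]
      refine isOpen_iUnion fun b => ?_
      by_cases hb : (n : ℝ) + 1 ≤ b
      · simpa [hb] using isOpen_lt continuous_const (T.continuous_mean (hpos n b hb))
      · simp [hb]
    · -- a vector `y` with null means close to `x`, plus a small vector `u` with a large late mean
      obtain ⟨y, hy, hxy⟩ := hdense.exists_dist_lt x (half_pos hr)
      obtain ⟨B, hB⟩ := eventually_atTop.1 (Tendsto.eventually_lt_const zero_lt_one hy)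
      obtain ⟨u, -, hu, b, hb, hub⟩ := exists_small_mem_meanNull hdense hT (half_pos hr)
        ((n : ℝ) + 1) (max B (n + 1))
      have hb' := (le_max_right _ _).trans hb
      refine ⟨y + u, ?_, b, hb', ?_⟩
      · rw [Metric.mem_ball, dist_eq_norm]
        rw [dist_comm, dist_eq_norm] at hxy
        calc ‖y + u - x‖ = ‖(y - x) + u‖ := by congr 1; abel
          _ ≤ ‖y - x‖ + ‖u‖ := norm_add_le _ _
          _ < r := by linarith
      · have h1 := T.mean_le_mean_add_mean_sub u (-y) (hpos n b hb').le
        have h2 : T.mean (-y) b = T.mean y b := by simpa using T.mean_smul (-1) y b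
        rw [sub_neg_eq_add, add_comm u y, h2] at h1
        linarith [hB b ((le_max_left _ _).trans hb)]
  filter_upwards [(countable_iInter_mem).2 hlow, (countable_iInter_mem).2 hupp] with x h1 h2
  exact IsAbsMeanIrregular.of_forall_nat (Set.mem_iInter.1 h1) (Set.mem_iInter.1 h2)

end Residual

/-! ### Dense irregular manifolds -/

section Manifold

variable [CompleteSpace X]

/-- A gliding hump: vectors `u n` with null means, together with times `b n` at which only `u n` has
a large mean, and times `c n` at which all of the `u m` have small means. -/
theorem exists_gliding_hump {T : C0Semigroup 𝕜 X} (hdense : Dense (T.meanNull : Set X))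
    (hT : ¬ T.IsMeanBounded) :
    ∃ (u : ℕ → X) (b c : ℕ → ℝ),
      (∀ n, ‖u n‖ ≤ (1 / 2 : ℝ) ^ n ∧ (n : ℝ) + 1 ≤ b n ∧ (n : ℝ) + 1 ≤ c n ∧
        n < T.mean (u n) (b n)) ∧
      (∀ m n, T.mean (u m) (c n) ≤ (1 / 2 : ℝ) ^ (m + n)) ∧
      ∀ m n, m ≠ n → T.mean (u m) (b n) ≤ (1 / 2 : ℝ) ^ (m + n) := by
  -- a quadruple `(u, b, c, k)` carries a rate `k`, which increases along the sequence
  let P : X × ℝ × ℝ × ℕ → Prop := fun q =>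
    q.1 ∈ T.meanNull ∧ ‖q.1‖ ≤ (1 / 2 : ℝ) ^ q.2.2.2 ∧ (q.2.2.2 : ℝ) + 1 ≤ q.2.1 ∧
      (q.2.2.2 : ℝ) + 1 ≤ q.2.2.1 ∧ q.2.2.2 < T.mean q.1 q.2.1 ∧
      T.mean q.1 q.2.2.1 ≤ (1 / 2 : ℝ) ^ (q.2.2.2 + q.2.2.2)
  let r : X × ℝ × ℝ × ℕ → X × ℝ × ℝ × ℕ → Prop := fun q q' =>
    q.2.2.2 < q'.2.2.2 ∧ T.mean q.1 q'.2.1 ≤ (1 / 2 : ℝ) ^ (q.2.2.2 + q'.2.2.2) ∧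
      T.mean q.1 q'.2.2.1 ≤ (1 / 2 : ℝ) ^ (q.2.2.2 + q'.2.2.2) ∧
      T.mean q'.1 q.2.1 ≤ (1 / 2 : ℝ) ^ (q'.2.2.2 + q.2.2.2) ∧
      T.mean q'.1 q.2.2.1 ≤ (1 / 2 : ℝ) ^ (q'.2.2.2 + q.2.2.2)
  have hstep : ∀ s : Finset (X × ℝ × ℝ × ℕ), (∀ q ∈ s, P q) → ∃ q', P q' ∧ ∀ q ∈ s, r q q' := by
    intro s hs
    set k : ℕ := s.sup (fun q => q.2.2.2) + 1 with hk
    have hlt : ∀ q ∈ s, q.2.2.2 < k := fun q hq =>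
      Nat.lt_succ_iff.2 (Finset.le_sup (f := fun q : X × ℝ × ℝ × ℕ => q.2.2.2) hq)
    obtain ⟨B₀, hB₀⟩ := (s.image fun q => max q.2.1 q.2.2.1).bddAbove
    have hB₀' : ∀ q ∈ s, max q.2.1 q.2.2.1 ≤ B₀ := fun q hq =>
      hB₀ (Finset.mem_coe.2 (Finset.mem_image_of_mem _ hq))
    obtain ⟨M, hM1, hM⟩ := T.exists_mean_le B₀
    have hev : ∀ᶠ t in atTop, ∀ q ∈ s, T.mean q.1 t < (1 / 2 : ℝ) ^ (q.2.2.2 + k) :=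
      (Filter.eventually_all_finset s).2 fun q hq =>
        Tendsto.eventually_lt_const (by positivity) (hs q hq).1
    obtain ⟨B₁, hB₁⟩ := eventually_atTop.1 hev
    obtain ⟨u, hu, huδ, b, hb, hub⟩ := exists_small_mem_meanNull hdense hT
      (δ := (1 / 2 : ℝ) ^ (k + k) / M) (by positivity) k (max B₁ (k + 1))
    obtain ⟨c, hc, huc⟩ := ((eventually_ge_atTop (max B₁ ((k : ℝ) + 1))).and
      (Tendsto.eventually_lt_const (by positivity : (0 : ℝ) < (1 / 2 : ℝ) ^ (k + k)) hu)).exists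
    have hMu : M * ‖u‖ ≤ (1 / 2 : ℝ) ^ (k + k) := by
      rw [lt_div_iff₀' (by linarith)] at huδ
      exact huδ.le
    have hold : ∀ q ∈ s, ∀ t, 0 < t → t ≤ B₀ → T.mean u t ≤ (1 / 2 : ℝ) ^ (k + q.2.2.2) :=
      fun q hq t ht htB => ((hM t ht htB u).trans hMu).trans
        (pow_le_pow_of_le_one (by norm_num) (by norm_num) (by have := hlt q hq; omega))
    have hpos : ∀ q ∈ s, 0 < q.2.1 ∧ 0 < q.2.2.1 := fun q hq => by
      obtain ⟨-, -, h1, h2, -⟩ := hs q hq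
      have := q.2.2.2.cast_nonneg (α := ℝ)
      exact ⟨by linarith, by linarith⟩
    refine ⟨(u, b, c, k), ⟨hu, ?_, (le_max_right _ _).trans hb, (le_max_right _ _).trans hc, hub,
      huc.le⟩, fun q hq => ⟨hlt q hq, (hB₁ b ((le_max_left _ _).trans hb) q hq).le,
      (hB₁ c ((le_max_left _ _).trans hc) q hq).le,
      hold q hq _ (hpos q hq).1 ((le_max_left _ _).trans (hB₀' q hq)),
      hold q hq _ (hpos q hq).2 ((le_max_right _ _).trans (hB₀' q hq))⟩⟩
    calc ‖u‖ ≤ M * ‖u‖ := le_mul_of_one_le_left (norm_nonneg _) hM1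
      _ ≤ (1 / 2 : ℝ) ^ (k + k) := hMu
      _ ≤ (1 / 2 : ℝ) ^ k :=
        pow_le_pow_of_le_one (by norm_num) (by norm_num) (Nat.le_add_left _ _)
  obtain ⟨f, hfP, hfr⟩ := exists_seq_of_forall_finset_exists P r hstep
  have hmono : StrictMono fun n => (f n).2.2.2 := fun m n hmn => (hfr m n hmn).1
  have hle : ∀ n, n ≤ (f n).2.2.2 := fun n => hmono.le_apply
  have hleR : ∀ n : ℕ, (n : ℝ) ≤ (f n).2.2.2 := fun n => by exact_mod_cast hle n
  have hpow : ∀ m n, (1 / 2 : ℝ) ^ ((f m).2.2.2 + (f n).2.2.2) ≤ (1 / 2 : ℝ) ^ (m + n) :=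
    fun m n => pow_le_pow_of_le_one (by norm_num) (by norm_num) (add_le_add (hle m) (hle n))
  refine ⟨fun n => (f n).1, fun n => (f n).2.1, fun n => (f n).2.2.1, fun n => ?_, fun m n => ?_,
    fun m n hmn => ?_⟩
  · obtain ⟨-, h1, h2, h3, h4, -⟩ := hfP n
    have := hleR n
    exact ⟨h1.trans (pow_le_pow_of_le_one (by norm_num) (by norm_num) (hle n)), by linarith,
      by linarith, by linarith⟩
  · refine le_trans ?_ (hpow m n)
    rcases lt_trichotomy m n with h | rfl | h
    · exact (hfr m n h).2.2.1
    · exact (hfP m).2.2.2.2.2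
    · exact (hfr n m h).2.2.2.2
  · refine le_trans ?_ (hpow m n)
    rcases lt_or_gt_of_ne hmn with h | h
    · exact (hfr m n h).2.1
    · exact (hfr n m h).2.2.2.1

/-- A sum `∑ β k • u k` along a gliding hump, with bounded coefficients that do not tend to `0`, is
absolutely mean irregular, and remains so after adding a vector with null means. -/
theorem isAbsMeanIrregular_of_gliding_hump {T : C0Semigroup 𝕜 X} {u : ℕ → X} {b c : ℕ → ℝ}
    (hb : ∀ n : ℕ, (n : ℝ) + 1 ≤ b n) (hc : ∀ n : ℕ, (n : ℝ) + 1 ≤ c n)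
    (hub : ∀ n, n < T.mean (u n) (b n))
    (hcu : ∀ m n, T.mean (u m) (c n) ≤ (1 / 2 : ℝ) ^ (m + n))
    (hbu : ∀ m n, m ≠ n → T.mean (u m) (b n) ≤ (1 / 2 : ℝ) ^ (m + n))
    {β : ℕ → 𝕜} {M a : ℝ} (hβ : ∀ k, ‖β k‖ ≤ M) (ha : 0 < a) (hfreq : ∃ᶠ k in atTop, a ≤ ‖β k‖)
    {d v : X} (hd : d ∈ T.meanNull) (hv : HasSum (fun k => β k • u k) v) :
    T.IsAbsMeanIrregular (d + v) := by
  have hM : 0 ≤ M := (norm_nonneg _).trans (hβ 0)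
  have hpos : ∀ (n : ℕ) (t : ℝ), (n : ℝ) + 1 ≤ t → 0 < t := fun n t ht => by
    have := n.cast_nonneg (α := ℝ)
    linarith
  have hbtop : Tendsto b atTop atTop := tendsto_atTop_mono hb
    (tendsto_atTop_add_const_right _ _ tendsto_natCast_atTop_atTop)
  have hctop : Tendsto c atTop atTop := tendsto_atTop_mono hc
    (tendsto_atTop_add_const_right _ _ tendsto_natCast_atTop_atTop)
  have hgeom : ∀ n : ℕ, HasSum (fun m : ℕ => M * (1 / 2 : ℝ) ^ (m + n))
      (M * (2 * (1 / 2 : ℝ) ^ n)) := fun n => by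
    simpa only [pow_add] using (hasSum_geometric_two.mul_right ((1 / 2 : ℝ) ^ n)).mul_left M
  have hvc : ∀ n, T.mean v (c n) ≤ M * (2 * (1 / 2 : ℝ) ^ n) := fun n => by
    refine T.mean_le_of_hasSum (hpos n _ (hc n)) hv (hgeom n) fun m => ?_
    rw [mean_smul]
    exact mul_le_mul (hβ m) (hcu m n) (T.mean_nonneg _ (hpos n _ (hc n)).le) hM
  have hvb : ∀ n, T.mean (v - β n • u n) (b n) ≤ M * 2 := fun n => by
    refine (T.mean_le_of_hasSum (hpos n _ (hb n)) (hasSum_ite_sub_hasSum hv n) (hgeom n)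
      fun m => ?_).trans ?_
    · split_ifs with h
      · rw [mean_zero]
        positivity
      · rw [mean_smul]
        exact mul_le_mul (hβ m) (hbu m n h) (T.mean_nonneg _ (hpos n _ (hb n)).le) hM
    · have : (1 / 2 : ℝ) ^ n ≤ 1 := pow_le_one₀ (by norm_num) (by norm_num)
      gcongr
      linarith
  have hdc : Tendsto (fun n => T.mean d (c n)) atTop (𝓝 0) := Tendsto.comp hd hctop
  have hdb : Tendsto (fun n => T.mean d (b n)) atTop (𝓝 0) := Tendsto.comp hd hbtop
  refine IsAbsMeanIrregular.of_forall_nat (fun n => ?_) fun n => ?_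
  · have hlim : Tendsto (fun k => T.mean d (c k) + M * (2 * (1 / 2 : ℝ) ^ k)) atTop (𝓝 0) := by
      simpa using hdc.add (((tendsto_pow_atTop_nhds_zero_of_lt_one (r := (1 / 2 : ℝ))
        (by norm_num) (by norm_num)).const_mul 2).const_mul M)
    obtain ⟨k, hk, hck⟩ := ((hlim.eventually_lt_const
      (by positivity : (0 : ℝ) < 1 / ((n : ℝ) + 1))).and
      (hctop.eventually_ge_atTop ((n : ℝ) + 1))).exists
    exact ⟨c k, hck, (T.mean_add_le d v (hpos n _ hck).le).trans_lt (by linarith [hvc k])⟩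
  · have hbig : ∀ᶠ k : ℕ in atTop, (n : ℝ) + 1 + M * 2 < a * k :=
      (tendsto_natCast_atTop_atTop.const_mul_atTop ha).eventually_gt_atTop _
    obtain ⟨k, hak, hk, hdk, hbk⟩ := (hfreq.and_eventually (hbig.and
      ((hdb.eventually_lt_const zero_lt_one).and
        (hbtop.eventually_ge_atTop ((n : ℝ) + 1))))).exists
    have hb0 := (hpos n _ hbk).le
    refine ⟨b k, hbk, ?_⟩
    have h1 : a * k ≤ T.mean (β k • u k) (b k) := by
      rw [mean_smul]
      exact mul_le_mul hak (hub k).le (Nat.cast_nonneg k) (norm_nonneg _)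
    have h2 := T.mean_le_mean_add_mean_sub (β k • u k) (d + v) hb0
    have h3 : T.mean (β k • u k - (d + v)) (b k) ≤
        T.mean d (b k) + T.mean (v - β k • u k) (b k) := by
      have h4 : T.mean (β k • u k - (d + v)) (b k) = T.mean (d + (v - β k • u k)) (b k) := by
        have := T.mean_smul (-1) (d + (v - β k • u k)) (b k)
        rw [norm_neg, norm_one, one_mul] at this
        rw [← this]
        congr 1
        rw [neg_one_smul]
        abel
      rw [h4]
      exact T.mean_add_le _ _ hb0
    linarith [hvb k]

/-- The manifold is spanned by vectors `d i + w i`, where `d` enumerates each member of a dense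
sequence of vectors with null means infinitely often, and where `w i` sums a gliding hump over
the `i`-th of infinitely many disjoint infinite sets of indices. -/
theorem exists_dense_isAbsMeanIrregularManifold {T : C0Semigroup 𝕜 X}
    [TopologicalSpace.SeparableSpace X]
    (hdense : Dense (T.meanNull : Set X)) (hT : ¬ T.IsMeanBounded) :
    ∃ Y : Submodule 𝕜 X, Dense (Y : Set X) ∧ T.IsAbsMeanIrregularManifold Y := by
  have : SecondCountableTopology X := UniformSpace.secondCountable_of_separable X
  obtain ⟨D, hDsub, hDc, hDd⟩ := hdense.exists_countable_dense_subset
  obtain ⟨d, rfl⟩ := hDc.exists_eq_range hDd.nonempty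
  have hd : ∀ j, d j ∈ T.meanNull := fun j => hDsub ⟨j, rfl⟩
  obtain ⟨u, b, c, hu, hcu, hbu⟩ := exists_gliding_hump hdense hT
  let e : ℕ → ℕ → 𝕜 := fun i k => if k.unpair.1 = i then 1 else 0
  have he : ∀ i k, ‖e i k • u k‖ ≤ (1 / 2 : ℝ) ^ k := fun i k => by
    rw [norm_smul]
    refine (mul_le_of_le_one_left (norm_nonneg _) ?_).trans (hu k).1
    simp only [e]
    split_ifs <;> simp
  have hgeom : Summable fun k : ℕ => (1 / 2 : ℝ) ^ k := summable_geometric_two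
  let w : ℕ → X := fun i => ∑' k, e i k • u k
  have hw : ∀ i, HasSum (fun k => e i k • u k) (w i) := fun i =>
    (Summable.of_norm_bounded hgeom (he i)).hasSum
  have hw0 : Tendsto w atTop (𝓝 0) := by
    have := tendsto_tsum_of_dominated_convergence (f := fun i k => e i k • u k) (g := fun _ => 0)
      (𝓕 := atTop) hgeom (fun k => ?_) (Eventually.of_forall fun i k => he i k)
    · simpa using this
    · refine tendsto_const_nhds.congr' ?_
      filter_upwards [eventually_gt_atTop k.unpair.1] with i hi
      simp [e, hi.ne]
  let x : ℕ → X := fun i => d i.unpair.1 + w i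
  refine ⟨Submodule.span 𝕜 (Set.range x), ?_, fun y hy hy0 => ?_⟩
  · refine Dense.of_closure (hDd.mono ?_)
    rintro _ ⟨j, rfl⟩
    have hpair : Tendsto (fun n => Nat.pair j n) atTop atTop :=
      tendsto_atTop_mono (fun n => Nat.right_le_pair j n) tendsto_id
    have hlim := (hw0.comp hpair).const_add (d j)
    rw [add_zero] at hlim
    refine mem_closure_of_tendsto hlim (Eventually.of_forall fun n => ?_)
    have hx : x (Nat.pair j n) = d j + w (Nat.pair j n) := by simp [x]
    exact hx ▸ Submodule.subset_span ⟨Nat.pair j n, rfl⟩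
  · obtain ⟨α, rfl⟩ := Finsupp.mem_span_range_iff_exists_finsupp.1 hy
    obtain ⟨i, hi⟩ := Finsupp.ne_iff.1 (show α ≠ 0 by rintro rfl; simp at hy0)
    have hsplit : (α.sum fun i a => a • x i) =
        ∑ i ∈ α.support, α i • d i.unpair.1 + ∑ i ∈ α.support, α i • w i := by
      simp only [Finsupp.sum, x, smul_add, Finset.sum_add_distrib]
    have hv : HasSum (fun k => α k.unpair.1 • u k) (∑ i ∈ α.support, α i • w i) := by
      convert hasSum_sum fun i (_ : i ∈ α.support) => (hw i).const_smul (α i) using 2 with k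
      simp only [e, ite_smul, one_smul, zero_smul, smul_ite, smul_zero, Finset.sum_ite_eq]
      split_ifs with h
      · rfl
      · rw [Finsupp.notMem_support_iff.1 h, zero_smul]
    rw [hsplit]
    refine isAbsMeanIrregular_of_gliding_hump (fun n => (hu n).2.1) (fun n => (hu n).2.2.1)
      (fun n => (hu n).2.2.2) hcu hbu (M := ∑ j ∈ α.support, ‖α j‖) (fun k => ?_)
      (norm_pos_iff.2 hi) (frequently_atTop.2 fun N => ?_)
      (Submodule.sum_mem _ fun i _ => Submodule.smul_mem _ _ (hd _)) hv
    · by_cases hk : k.unpair.1 ∈ α.support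
      · exact Finset.single_le_sum (f := fun j => ‖α j‖) (fun _ _ => norm_nonneg _) hk
      · rw [Finsupp.notMem_support_iff.1 hk, norm_zero]
        exact Finset.sum_nonneg fun _ _ => norm_nonneg _
    · exact ⟨Nat.pair i N, Nat.right_le_pair i N, by simp⟩

end Manifold

end C0Semigroup

theorem theorem7p4 {𝕜 : Type*} [RCLike 𝕜] {X : Type*} [NormedAddCommGroup X] [NormedSpace 𝕜 X]
    [CompleteSpace X] (T : C0Semigroup 𝕜 X)
    (hdense : Dense {x : X | Tendsto (fun b : ℝ => T.mean x b) atTop (𝓝 0)})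
    (hcond :
      (∃ y₀ : X, 0 < limsup (fun b : ℝ => (T.mean y₀ b : EReal)) atTop) ∨
      (0 < limsup (fun t : ℝ≥0 => ((‖T.op t‖ / (t : ℝ) : ℝ) : EReal)) atTop) ∨
      (NormFromInner 𝕜 X ∧
        0 < limsup (fun t : ℝ≥0 => ((‖T.op t‖ / Real.sqrt (t : ℝ) : ℝ) : EReal)) atTop) ∨
      (∃ μ ∈ T.generator.pointSpectrum, 0 ≤ RCLike.re μ)) :
    {x : X | T.IsAbsMeanIrregular x} ∈ residual X ∧
      (TopologicalSpace.SeparableSpace X →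
        ∃ Y : Submodule 𝕜 X, Dense (Y : Set X) ∧ T.IsAbsMeanIrregularManifold Y) := by
  have hnull : Dense (T.meanNull : Set X) := hdense
  have hT : ¬ T.IsMeanBounded := by
    rcases hcond with ⟨y, hy⟩ | h | ⟨hX, h⟩ | ⟨μ, hμ, hre⟩
    · exact C0Semigroup.not_isMeanBounded_of_limsup_mean_pos hnull hy
    · exact C0Semigroup.not_isMeanBounded_of_limsup_norm_op_div_pos h
    · exact C0Semigroup.not_isMeanBounded_of_limsup_norm_op_div_sqrt_pos hX h
    · obtain ⟨y, hy⟩ := C0Semigroup.limsup_mean_pos_of_mem_pointSpectrum hμ hre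
      exact C0Semigroup.not_isMeanBounded_of_limsup_mean_pos hnull hy
  exact ⟨C0Semigroup.isAbsMeanIrregular_mem_residual hnull hT, fun _ =>
    C0Semigroup.exists_dense_isAbsMeanIrregularManifold hnull hT⟩
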